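/- Let $\mathbf{T}^2=\mathbf{R}^2/\mathbf{Z}^2$ with covering projection $\pi\colon\mathbf{R}^2\to\mathbf{T}^2$, and let $\mathcal{H}$ be either the set $\operatorname{Homeo}_0(\mathbf{T}^2)$ of homeomorphisms of $\mathbf{T}^2$ isotopic to the identity, or its subset of those that preserve Lebesgue measure. Let $f\in\mathcal{H}$ and let $\tilde f\colon\mathbf{R}^2\to\mathbf{R}^2$ be a lift of $f$, i.e. a continuous map with $\pi\circ\tilde f=f\circ\pi$. The rotation set $\rho(\tilde f)$ is the set of all limits $$\lim_{k\to\infty}\frac{\tilde f^{n_k}(z_k)-z_k}{n_k},$$ where $(n_k)$ is a sequence of natural numbers with $n_k\to\infty$ and $(z_k)$ is a sequence of points of $\mathbf{R}^2$. For $\varepsilon>0$, a finite sequence $(x_i)_{0\le i\le n}$ in $\mathbf{R}^2$ is an $\varepsilon$-pseudo-orbit of $\tilde f$ if $\|\tilde f(x_i)-x_{i+1}\|<\varepsilon$ for all $0\le i<n$. The $\varepsilon$-pseudo-rotation set $\rho_\varepsilon(\tilde f)$ is the set of all limits $$\lim_{k\to\infty}\frac{x^k_{n_k}-x^k_0}{n_k},$$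 where $n_k\to\infty$ and, for each $k$, $(x^k_i)_{0\le i\le n_k}$ is an $\varepsilon$-pseudo-orbit of $\tilde f$. Let $\rho_{\mathrm{p.o.}}(\tilde f)=\bigcap_{\varepsilon>0}\rho_\varepsilon(\tilde f)$ be the pseudo-rotation set. Then $$\rho_{\mathrm{p.o.}}(\tilde f)=\rho(\tilde f).$$ -/

import Mathlib

open Filter Topology MeasureTheory

noncomputable section

namespace TorusRotation

/-- The plane `ℝ²` with its Euclidean norm. -/
abbrev Plane : Type := EuclideanSpace ℝ (Fin 2)

/-- The torus `𝕋² = ℝ²/ℤ²`, as the product of two copies of the circle `ℝ/ℤ`. -/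
abbrev Torus : Type := UnitAddTorus (Fin 2)

/-- The covering projection `π : ℝ² → 𝕋²`. -/
def proj (x : Plane) : Torus := fun i => (x i : UnitAddCircle)

/-- `f` is isotopic to the identity: some homotopy from the identity to `f` consists of
homeomorphisms. -/
def IsotopicToId (f : Torus ≃ₜ Torus) : Prop :=
  ∃ Φ : ContinuousMap.Homotopy (ContinuousMap.id Torus) (f : C(Torus, Torus)),
    ∀ t : unitInterval, IsHomeomorph fun x : Torus => Φ (t, x)

/-- `Homeo₀(𝕋²)`: the homeomorphisms of the torus isotopic to the identity. -/
def Homeo₀ : Set (Torus ≃ₜ Torus) := {f | IsotopicToId f}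

/-- The elements of `Homeo₀(𝕋²)` that preserve the area (Lebesgue) measure. -/
def Homeo₀Area : Set (Torus ≃ₜ Torus) :=
  {f | f ∈ Homeo₀ ∧ MeasurePreserving f (volume : Measure Torus) volume}

/-- `F : ℝ² → ℝ²` is a lift of `f`: it is continuous and `π ∘ F = f ∘ π`. -/
def IsLift (F : Plane → Plane) (f : Torus ≃ₜ Torus) : Prop :=
  Continuous F ∧ ∀ x, proj (F x) = f (proj x)

/-- The rotation set `ρ(F)`: all limits of `(Fⁿᵏ(zₖ) - zₖ) / nₖ` with `nₖ → ∞`. -/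
def rotationSet (F : Plane → Plane) : Set Plane :=
  {v | ∃ (n : ℕ → ℕ) (z : ℕ → Plane), Tendsto n atTop atTop ∧
    Tendsto (fun k => (n k : ℝ)⁻¹ • (F^[n k] (z k) - z k)) atTop (𝓝 v)}

/-- The finite sequence `x 0, …, x n` is an `ε`-pseudo-orbit of `F`
(the values of `x` beyond `n` play no role). -/
def IsPseudoOrbit (F : Plane → Plane) (ε : ℝ) (n : ℕ) (x : ℕ → Plane) : Prop :=
  ∀ i < n, dist (F (x i)) (x (i + 1)) < ε

/-- The `ε`-pseudo-rotation set `ρ_ε(F)`: all limits of `(xᵏ_{nₖ} - xᵏ_0) / nₖ` with `nₖ → ∞`,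
where `(xᵏ_i)` for `0 ≤ i ≤ nₖ` is an `ε`-pseudo-orbit of `F` for each `k`. -/
def epsPseudoRotationSet (F : Plane → Plane) (ε : ℝ) : Set Plane :=
  {v | ∃ (n : ℕ → ℕ) (x : ℕ → ℕ → Plane), Tendsto n atTop atTop ∧
    (∀ k, IsPseudoOrbit F ε (n k) (x k)) ∧
    Tendsto (fun k => (n k : ℝ)⁻¹ • (x k (n k) - x k 0)) atTop (𝓝 v)}

/-- The pseudo-rotation set: the intersection of the `ε`-pseudo-rotation sets over `ε > 0`. -/
def pseudoRotationSet (F : Plane → Plane) : Set Plane :=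
  ⋂ (ε : ℝ) (_ : 0 < ε), epsPseudoRotationSet F ε

end TorusRotation

end

namespace TorusRotation

/-! Orbits are pseudo-orbits, so only one inclusion has content. Let `v` be a pseudo-rotation vector
and fix `n`. For small ε, a long ε-pseudo-orbit cut into blocks of length `n` follows a true orbit
on each block, so `n • v` lies within 2 of the convex hull of the displacements of `F^[n]`
(`exists_mem_convexHull_near`). Those displacements are coarsely convex with a constant independent
of `n` (`exists_displacement_near`). Hence some displacement of `F^[n]` is within 10 of `n • v`, and
dividing by `n` gives `v` as a rotation vector.

Coarse convexity holds for every continuous injective `G` commuting with integer translations.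
Suppose `p` is in the hull of `G(D)`, with `D` the unit disk, but far from `G(D)`. Since `D` is
convex, `G x - p` has a continuous argument on `D`. At a point maximizing height in direction `u`,
it lies within π/2 of `u`, up to `2πj`. By `exists_common_sector`, `j` depends only on `u`, so by
connectedness it cannot change as `u` runs over `[0, 2π]`. Yet a full turn with the same maximizer
lowers it by one. -/

/-! ### Continuous arguments and sectors. -/

/-- A nonvanishing continuous function on a nonempty convex set has a continuous logarithm. -/
theorem exists_continuousOn_log {E : Type*} [NormedAddCommGroup E] [NormedSpace ℝ E] {S : Set E}
    (hS : Convex ℝ S) (hne : S.Nonempty) {q : E → ℂ} (hq : ContinuousOn q S)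
    (h0 : ∀ x ∈ S, q x ≠ 0) :
    ∃ A : E → ℂ, ContinuousOn A S ∧ ∀ x ∈ S, Complex.exp (A x) = q x := by
  classical
  have := hS.contractibleSpace hne
  have := hS.locallyPathConnectedSpace
  obtain ⟨x₀, hx₀⟩ := hne
  obtain ⟨f, ⟨-, hf⟩, -⟩ := Complex.isCoveringMapOn_exp.existsUnique_continuousMap_lifts
    ⟨fun x : S => q x, hq.comp_continuous continuous_subtype_val fun x => x.2⟩
    (a₀ := ⟨x₀, hx₀⟩) (Complex.exp_log (h0 x₀ hx₀)) (fun x => h0 x x.2)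
  refine ⟨fun x => if hx : x ∈ S then f ⟨x, hx⟩ else 0, ?_, fun x hx => ?_⟩
  · rw [continuousOn_iff_continuous_domRestrict]
    convert! map_continuous f
    ext z
    simp
  · simpa [hx] using congrFun hf ⟨x, hx⟩

theorem sector_unique {t : ℝ} {i j : ℤ} (hi : |t - 2 * Real.pi * i| ≤ Real.pi / 2)
    (hj : |t - 2 * Real.pi * j| ≤ Real.pi / 2) : i = j := by
  have hpi := Real.pi_pos
  rw [abs_le] at hi hj
  have h1 : (i : ℝ) < j + 1 := by nlinarith
  have h2 : (j : ℝ) < i + 1 := by nlinarith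
  have h1' : i < j + 1 := by exact_mod_cast h1
  have h2' : j < i + 1 := by exact_mod_cast h2
  omega

theorem exists_sector_of_cos_nonneg {t : ℝ} (h : 0 ≤ Real.cos t) :
    ∃ j : ℤ, |t - 2 * Real.pi * j| ≤ Real.pi / 2 := by
  obtain ⟨j, hj, -⟩ := existsUnique_sub_zsmul_mem_Ioc Real.two_pi_pos t (-Real.pi)
  refine ⟨j, ?_⟩
  rw [zsmul_eq_mul, mul_comm (j : ℝ), Set.mem_Ioc] at hj
  have hc : 0 ≤ Real.cos (t - 2 * Real.pi * j) := by
    rwa [mul_comm, Real.cos_sub_int_mul_two_pi]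
  by_contra hlt
  rw [not_le] at hlt
  rw [← Real.cos_abs] at hc
  have : |t - 2 * Real.pi * j| ≤ Real.pi := abs_le.2 ⟨hj.1.le, by linarith [hj.2]⟩
  exact absurd hc (not_le.2 (Real.cos_neg_of_pi_div_two_lt_of_lt hlt
    (by linarith [Real.pi_pos])))

/-- A continuous angle on a connected set that stays in the half-circle of nonnegative cosine
modulo `2π` stays in one half-circle of the line. -/
theorem exists_sector_of_isPreconnected {X : Type*} [TopologicalSpace X] {S : Set X}
    (hS : IsPreconnected S) {s₀ : X} (hs₀ : s₀ ∈ S) {θ : X → ℝ} (hθ : ContinuousOn θ S) (u : ℝ)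
    (h : ∀ s ∈ S, 0 ≤ Real.cos (θ s - u)) :
    ∃ j : ℤ, ∀ s ∈ S, |θ s - u - 2 * Real.pi * j| ≤ Real.pi / 2 := by
  have hpi := Real.pi_pos
  obtain ⟨j, hj⟩ := exists_sector_of_cos_nonneg (h s₀ hs₀)
  refine ⟨j, fun s hs => ?_⟩
  have hc : ContinuousOn (fun s => θ s - u - 2 * Real.pi * j) S := by fun_prop
  have hcos : ∀ s ∈ S, 0 ≤ Real.cos (θ s - u - 2 * Real.pi * j) := by
    intro s hs
    rw [mul_comm, Real.cos_sub_int_mul_two_pi]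
    exact h s hs
  rw [abs_le] at hj
  have hord := (hS.image _ hc).ordConnected
  have m0 := Set.mem_image_of_mem (fun s => θ s - u - 2 * Real.pi * j) hs₀
  have ms := Set.mem_image_of_mem (fun s => θ s - u - 2 * Real.pi * j) hs
  rw [abs_le]
  constructor
  · by_contra! hlt
    -- Intermediate value: clipping at -π gives an attained angle in `[-π, -π/2)`, where the cosine
    -- is negative.
    obtain ⟨s', hs', he⟩ := hord.out ms m0
      (show max (θ s - u - 2 * Real.pi * j) (-Real.pi) ∈ _ from
        ⟨le_max_left _ _, max_le (by linarith) (by linarith)⟩)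
    have h1 := hcos s' hs'
    simp only at he
    rw [he, ← Real.cos_neg] at h1
    refine absurd h1 (not_le.2 (Real.cos_neg_of_pi_div_two_lt_of_lt ?_ ?_))
    · rw [lt_neg]
      exact max_lt hlt (by linarith)
    · linarith [le_max_right (θ s - u - 2 * Real.pi * j) (-Real.pi)]
  · by_contra! hlt
    obtain ⟨s', hs', he⟩ := hord.out m0 ms
      (show min (θ s - u - 2 * Real.pi * j) Real.pi ∈ _ from
        ⟨le_min (by linarith) (by linarith), min_le_left _ _⟩)
    have h1 := hcos s' hs'
    simp only at he
    rw [he] at h1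
    refine absurd h1 (not_le.2 (Real.cos_neg_of_pi_div_two_lt_of_lt ?_ ?_))
    · exact lt_min hlt (by linarith)
    · linarith [min_le_right (θ s - u - 2 * Real.pi * j) Real.pi]

/-! ### Heights in a direction. -/

/-- The component of `v` in the direction of angle `u`. -/
noncomputable def height (u : ℝ) (v : ℂ) : ℝ := v.re * Real.cos u + v.im * Real.sin u

theorem height_add (u : ℝ) (v w : ℂ) : height u (v + w) = height u v + height u w := by
  simp only [height, Complex.add_re, Complex.add_im]; ring

theorem height_sub (u : ℝ) (v w : ℂ) : height u (v - w) = height u v - height u w := by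
  simp only [height, Complex.sub_re, Complex.sub_im]; ring

theorem height_exp (u : ℝ) (a : ℂ) :
    height u (Complex.exp a) = Real.exp a.re * Real.cos (a.im - u) := by
  rw [height, Complex.exp_re, Complex.exp_im, Real.cos_sub]; ring

theorem height_le_norm (u : ℝ) (v : ℂ) : height u v ≤ ‖v‖ := by
  refine Real.le_sqrt_of_sq_le ?_ |>.trans_eq (Complex.norm_eq_sqrt_sq_add_sq v).symm
  have := Real.sin_sq_add_cos_sq u
  rw [height]
  nlinarith [sq_nonneg (v.re * Real.sin u - v.im * Real.cos u)]

theorem continuous_height : Continuous fun t : ℝ × ℂ => height t.1 t.2 := by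
  unfold height
  fun_prop

theorem cos_im_sub_nonneg {u : ℝ} {a : ℂ} (h : 0 ≤ height u (Complex.exp a)) :
    0 ≤ Real.cos (a.im - u) := by
  rw [height_exp] at h
  exact nonneg_of_mul_nonneg_right h (Real.exp_pos _)

theorem convex_height_le (u c : ℝ) : Convex ℝ {v | height u v ≤ c} := by
  intro v hv w hw a b ha hb hab
  simp only [Set.mem_ofPred_eq, height, Complex.add_re, Complex.add_im, Complex.real_smul,
    Complex.mul_re, Complex.mul_im, Complex.ofReal_re, Complex.ofReal_im] at *
  have : c = a * c + b * c := by rw [← add_mul, hab, one_mul]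
  rw [this]
  nlinarith

theorem segment_height_le {u c : ℝ} {v w : ℂ} (hv : height u v ≤ c) (hw : height u w ≤ c) :
    ∀ z ∈ segment ℝ v w, height u z ≤ c :=
  fun _ hz => (convex_height_le u c).segment_subset hv hw hz

theorem exists_gaussianInt_close (z : ℂ) : ∃ a b : ℤ, ‖z - (a + b * Complex.I)‖ ≤ 3 / 4 := by
  refine ⟨round z.re, round z.im, ?_⟩
  rw [Complex.norm_eq_sqrt_sq_add_sq]
  refine Real.sqrt_le_iff.2 ⟨by norm_num, ?_⟩
  have h1 := abs_le.1 (abs_sub_round z.re)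
  have h2 := abs_le.1 (abs_sub_round z.im)
  simp
  nlinarith

/-- Two continuous branches of the argument of the same function differ by a constant. -/
theorem exists_int_of_exp_eq {X : Type*} [TopologicalSpace X] {S : Set X}
    (hS : IsPreconnected S) {s₀ : X} (hs₀ : s₀ ∈ S) {A B : X → ℂ} (hA : ContinuousOn A S)
    (hB : ContinuousOn B S) (h : ∀ s ∈ S, Complex.exp (A s) = Complex.exp (B s)) :
    ∃ k : ℤ, ∀ s ∈ S, (A s).im = (B s).im + 2 * Real.pi * k := by
  have hk : ∀ s ∈ S, ∃ k : ℤ, (A s).im - (B s).im - 0 - 2 * Real.pi * k = 0 := by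
    intro s hs
    obtain ⟨k, hk⟩ := Complex.exp_eq_exp_iff_exists_int.1 (h s hs)
    refine ⟨k, ?_⟩
    rw [hk]
    simp
    ring
  -- The difference is a multiple of 2π, so its cosine is 1; a sector contains only one such
  -- multiple.
  obtain ⟨j, hj⟩ := exists_sector_of_isPreconnected (θ := fun s => (A s).im - (B s).im) hS hs₀
    ((Complex.continuous_im.comp_continuousOn hA).sub (Complex.continuous_im.comp_continuousOn hB))
    0 (by
      intro s hs
      obtain ⟨k, hk⟩ := hk s hs
      have : (A s).im - (B s).im - 0 = k * (2 * Real.pi) := by linarith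
      rw [this, Real.cos_int_mul_two_pi]
      exact zero_le_one)
  refine ⟨j, fun s hs => ?_⟩
  obtain ⟨k, hk⟩ := hk s hs
  have hkj : k = j := sector_unique (by rw [hk, abs_zero]; positivity) (hj s hs)
  subst hkj
  linarith

/-! ### Coarse convexity of the image of the disk. -/

/-- If an injective map commuting with the integer translations sends the unit disk far from
`p`, then the directions from `p` to any two points of the image maximizing the height in the
direction `u` lie in the same half-turn around `u`, for a continuous choice of the argument. -/
theorem exists_common_sector {G : ℂ → ℂ} (hG : Continuous G) (hinj : Function.Injective G)
    (hper : ∀ (x : ℂ) (a b : ℤ), G (x + (a + b * Complex.I)) = G x + (a + b * Complex.I))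
    {p : ℂ} (hfar : ∀ x ∈ Metric.closedBall (0 : ℂ) 1, 5 < ‖G x - p‖)
    {A : ℂ × ℂ → ℂ}
    (hA : ContinuousOn A (Metric.closedBall (0 : ℂ) 1 ×ˢ Metric.closedBall p 2))
    (hexp : ∀ t ∈ Metric.closedBall (0 : ℂ) 1 ×ˢ Metric.closedBall p 2,
      Complex.exp (A t) = G t.1 - t.2)
    {u : ℝ} {x y : ℂ} (hx : x ∈ Metric.closedBall (0 : ℂ) 1)
    (hy : y ∈ Metric.closedBall (0 : ℂ) 1)
    (hxmax : ∀ a ∈ Metric.closedBall (0 : ℂ) 1, height u (G a) ≤ height u (G x))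
    (hymax : ∀ a ∈ Metric.closedBall (0 : ℂ) 1, height u (G a) ≤ height u (G y))
    (hp : height u p ≤ height u (G x)) :
    ∃ j : ℤ, |(A (x, p)).im - u - 2 * Real.pi * j| ≤ Real.pi / 2 ∧
      |(A (y, p)).im - u - 2 * Real.pi * j| ≤ Real.pi / 2 := by
  set D := Metric.closedBall (0 : ℂ) 1 with hD
  have hDc : Convex ℝ D := convex_closedBall 0 1
  have hxy : height u (G x) = height u (G y) := le_antisymm (hymax x hx) (hxmax y hy)
  set e : ℂ := Complex.exp (u * Complex.I) with he
  have hee : height u e = 1 := by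
    rw [he, height_exp]
    simp
  have hen : ‖e‖ = 1 := Complex.norm_exp_ofReal_mul_I u
  -- Translate `G x` by an integer vector to a point `z` near `p - e`. As 3/4 < 1, `z` is lower than
  -- `p`, and it stays in the ball of radius 2 where `A` is defined.
  obtain ⟨a, b, hab⟩ := exists_gaussianInt_close (G x - (p - e))
  set m : ℂ := a + b * Complex.I with hm
  set z : ℂ := G x - m with hz
  have hzp : ‖z - (p - e)‖ ≤ 3 / 4 := by
    rw [hz]; convert hab using 2; ring
  have hzB : z ∈ Metric.closedBall p 2 := by
    rw [mem_closedBall_iff_norm]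
    calc ‖z - p‖ = ‖(z - (p - e)) - e‖ := by congr 1; ring
      _ ≤ ‖z - (p - e)‖ + ‖e‖ := norm_sub_le _ _
      _ ≤ 2 := by rw [hen]; linarith
  have hpB : p ∈ Metric.closedBall p 2 := Metric.mem_closedBall_self (by norm_num)
  have hm2 : 2 < ‖m‖ := by
    have h1 : ‖G x - p‖ ≤ ‖m‖ + ‖z - p‖ := by
      calc ‖G x - p‖ = ‖m + (z - p)‖ := by congr 1; rw [hz]; ring
        _ ≤ _ := norm_add_le _ _
    have := hfar x hx
    rw [mem_closedBall_iff_norm] at hzB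
    linarith
  have hzh : height u z < height u p := by
    have h1 := height_le_norm u (z - (p - e))
    rw [height_sub u z, height_sub u p, hee] at h1
    linarith
  have hmh : 0 < height u m := by
    have : height u z = height u (G x) - height u m := height_sub _ _ _
    linarith
  -- Since `‖m‖` exceeds the diameter of `D`, the disks `D` and `D + m` are disjoint; by injectivity
  -- so are their images.
  have hne : ∀ t ∈ D ×ˢ D, G t.2 - G t.1 + m ≠ 0 := by
    rintro ⟨c, d⟩ ⟨hc, hd⟩ h0
    have h1 : G (d + m) = G c := by
      rw [hm, hper, ← hm]
      linear_combination h0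
    have h2 : m = c - d := by linear_combination hinj h1
    have h3 : ‖m‖ ≤ ‖c‖ + ‖d‖ := h2 ▸ norm_sub_le _ _
    have hc' : ‖c‖ ≤ 1 := mem_closedBall_zero_iff.1 hc
    have hd' : ‖d‖ ≤ 1 := mem_closedBall_zero_iff.1 hd
    linarith
  obtain ⟨B, hBc, hB⟩ := exists_continuousOn_log (E := ℂ × ℂ)
    (q := fun t : ℂ × ℂ => G t.2 - G t.1 + m) (hDc.prod hDc) ⟨(x, x), hx, hx⟩
    (((hG.comp continuous_snd).sub (hG.comp continuous_fst)).add
      (continuous_const (y := m))).continuousOn hne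
  -- On the diagonal and on `D × {y}` the difference `G b - G a + m` has positive height.
  obtain ⟨j, hj⟩ := exists_sector_of_isPreconnected (θ := fun t => (B t).im)
    (S := (fun c : ℂ => (c, c)) '' D ∪ (fun c : ℂ => (c, y)) '' D)
    (IsPreconnected.union (y, y) ⟨y, hy, rfl⟩ ⟨y, hy, rfl⟩
      (hDc.isPreconnected.image _ (by fun_prop)) (hDc.isPreconnected.image _ (by fun_prop)))
    (s₀ := (x, x)) (Or.inl ⟨x, hx, rfl⟩)
    (Complex.continuous_im.comp_continuousOn (hBc.mono (by
      rintro _ (⟨c, hc, rfl⟩ | ⟨c, hc, rfl⟩)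
      exacts [⟨hc, hc⟩, ⟨hc, hy⟩]))) u (by
      rintro _ (⟨c, hc, rfl⟩ | ⟨c, hc, rfl⟩) <;> apply cos_im_sub_nonneg
      · rw [hB _ ⟨hc, hc⟩]
        simpa using hmh.le
      · rw [hB _ ⟨hc, hy⟩, height_add, height_sub]
        linarith [hymax c hc])
  have hjx := hj (x, x) (Or.inl ⟨x, hx, rfl⟩)
  have hjy := hj (x, y) (Or.inr ⟨x, hx, rfl⟩)
  -- As `z = G x - m`, both branches are arguments of `G c - z`.
  obtain ⟨k, hk⟩ := exists_int_of_exp_eq (A := fun c => A (c, z)) (B := fun c => B (x, c))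
    hDc.isPreconnected hx
    (hA.comp (by fun_prop) fun c hc => ⟨hc, hzB⟩)
    (hBc.comp (by fun_prop) fun c hc => ⟨hx, hc⟩)
    (by
      intro c hc
      rw [hexp _ ⟨hc, hzB⟩, hB _ ⟨hx, hc⟩, hz]
      simp only
      ring)
  -- Moving the base point from `z` to `p` keeps the sector.
  have key : ∀ c ∈ D, height u p ≤ height u (G c) →
      |(B (x, c)).im - u - 2 * Real.pi * j| ≤ Real.pi / 2 →
      |(A (c, p)).im - u - 2 * Real.pi * (j + k : ℤ)| ≤ Real.pi / 2 := by
    intro c hc hpc hjc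
    have hseg : segment ℝ z p ⊆ Metric.closedBall p 2 :=
      (convex_closedBall p 2).segment_subset hzB hpB
    obtain ⟨i, hi⟩ := exists_sector_of_isPreconnected (θ := fun w => (A (c, w)).im)
      (convex_segment z p).isPreconnected (left_mem_segment ℝ z p)
      (Complex.continuous_im.comp_continuousOn
        (hA.comp (by fun_prop) fun w hw => ⟨hc, hseg hw⟩)) u (by
        intro w hw
        apply cos_im_sub_nonneg
        rw [hexp _ ⟨hc, hseg hw⟩, height_sub]
        have := segment_height_le (by linarith) hpc w hw
        simp only
        linarith)
    have h1 := hi z (left_mem_segment ℝ z p)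
    have h2 : |(A (c, z)).im - u - 2 * Real.pi * (j + k : ℤ)| ≤ Real.pi / 2 := by
      rw [hk c hc]
      push_cast
      convert hjc using 2
      ring
    rw [← sector_unique h1 h2]
    exact hi p (right_mem_segment ℝ z p)
  exact ⟨j + k, key x hx hp hjx, key y hy (hxy ▸ hp) hjy⟩

/-- The image of the unit disk under an injective map commuting with the integer translations
is coarsely convex, with a universal constant. -/
theorem exists_near_of_mem_convexHull {G : ℂ → ℂ} (hG : Continuous G)
    (hinj : Function.Injective G)
    (hper : ∀ (x : ℂ) (a b : ℤ), G (x + (a + b * Complex.I)) = G x + (a + b * Complex.I))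
    {p : ℂ} (hp : p ∈ convexHull ℝ (G '' Metric.closedBall (0 : ℂ) 1)) :
    ∃ x ∈ Metric.closedBall (0 : ℂ) 1, ‖G x - p‖ ≤ 5 := by
  by_contra! hfar
  have hpi := Real.pi_pos
  set D := Metric.closedBall (0 : ℂ) 1 with hD
  have hDne : D.Nonempty := ⟨0, Metric.mem_closedBall_self zero_le_one⟩
  have hDK : IsCompact D := isCompact_closedBall 0 1
  have hpB : p ∈ Metric.closedBall p 2 := Metric.mem_closedBall_self (by norm_num)
  obtain ⟨A, hA, hexp⟩ := exists_continuousOn_log (E := ℂ × ℂ)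
    (q := fun t : ℂ × ℂ => G t.1 - t.2)
    ((convex_closedBall (0 : ℂ) 1).prod (convex_closedBall p 2)) (hDne.prod ⟨p, hpB⟩)
    ((hG.comp continuous_fst).sub continuous_snd).continuousOn (by
      rintro ⟨c, w⟩ ⟨hc, hw⟩ h0
      have h1 := hfar c hc
      rw [sub_eq_zero.1 h0] at h1
      rw [mem_closedBall_iff_norm] at hw
      simp only at h1 hw
      linarith)
  have hphull : ∀ (u : ℝ) (x : ℂ), (∀ a ∈ D, height u (G a) ≤ height u (G x)) →
      height u p ≤ height u (G x) := by
    intro u x hx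
    refine convexHull_min ?_ (convex_height_le u (height u (G x))) hp
    rintro _ ⟨a, ha, rfl⟩
    exact hx a ha
  have hface : ∀ u : ℝ, ∃ x ∈ D, ∀ a ∈ D, height u (G a) ≤ height u (G x) := by
    intro u
    exact hDK.exists_isMaxOn hDne (f := fun a => height u (G a))
      (continuous_height.comp (continuous_const.prodMk hG)).continuousOn
  have hsec : ∀ (u : ℝ), ∀ x ∈ D, ∀ y ∈ D, (∀ a ∈ D, height u (G a) ≤ height u (G x)) →
      (∀ a ∈ D, height u (G a) ≤ height u (G y)) →
      ∃ j : ℤ, |(A (x, p)).im - u - 2 * Real.pi * j| ≤ Real.pi / 2 ∧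
        |(A (y, p)).im - u - 2 * Real.pi * j| ≤ Real.pi / 2 :=
    fun u x hx y hy hxm hym =>
      exists_common_sector hG hinj hper hfar hA hexp hx hy hxm hym (hphull u x hxm)
  obtain ⟨x₀, hx₀, hmax₀⟩ := hface 0
  obtain ⟨j₀, hj₀, -⟩ := hsec 0 x₀ hx₀ x₀ hx₀ hmax₀ hmax₀
  rw [abs_le] at hj₀
  -- Pairs of a direction and a maximizer. Compactness makes the directions satisfying a closed
  -- condition on the relative angle a closed set.
  set T : Set (ℝ × ℂ) := {t | t ∈ Set.Icc 0 (2 * Real.pi) ×ˢ D ∧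
    ∀ a ∈ D, height t.1 (G a) ≤ height t.1 (G t.2)} with hT
  have hTK : IsCompact T := by
    have : T = (Set.Icc 0 (2 * Real.pi) ×ˢ D) ∩
        ⋂ a ∈ D, {t : ℝ × ℂ | height t.1 (G a) ≤ height t.1 (G t.2)} := by
      ext t
      simp [hT]
    rw [this]
    refine (isCompact_Icc.prod hDK).inter_right (isClosed_biInter fun a _ => ?_)
    exact isClosed_le (continuous_height.comp (continuous_fst.prodMk continuous_const))
      (continuous_height.comp (continuous_fst.prodMk (hG.comp continuous_snd)))
  have hφ : ContinuousOn (fun t : ℝ × ℂ => (A (t.2, p)).im - t.1) T :=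
    (Complex.continuous_im.comp_continuousOn
      (hA.comp (by fun_prop) fun t ht => ⟨ht.1.2, hpB⟩)).sub continuousOn_fst
  have hclosed : ∀ C : Set ℝ, IsClosed C → IsClosed
      (Prod.fst '' (T ∩ (fun t : ℝ × ℂ => (A (t.2, p)).im - t.1) ⁻¹' C)) := by
    intro C hC
    refine IsCompact.isClosed (IsCompact.image ?_ continuous_fst)
    exact hTK.of_isClosed_subset (hφ.preimage_isClosed_of_isClosed hTK.isClosed hC)
      Set.inter_subset_left
  -- At `2π` the same maximizer serves, but the angle relative to the direction has dropped by 2π.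
  have hmaxpi : ∀ a ∈ D, height (2 * Real.pi) (G a) ≤ height (2 * Real.pi) (G x₀) := by
    simpa [height] using hmax₀
  -- The two closed sets collect directions with a maximizer in a sector `j ≥ j₀`, respectively `j ≤
  -- j₀ - 1`. A common direction contradicts `hsec`.
  obtain ⟨u, hu, ⟨⟨_, x⟩, ⟨hx, hx1⟩, rfl⟩, ⟨⟨v, y⟩, ⟨hy, hy1⟩, hv⟩⟩ :=
    isPreconnected_closed_iff.1 (isPreconnected_Icc (a := (0 : ℝ)) (b := 2 * Real.pi)) _ _
      (hclosed (Set.Ici (2 * Real.pi * j₀ - Real.pi / 2)) isClosed_Ici)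
      (hclosed (Set.Iic (2 * Real.pi * j₀ - 3 * Real.pi / 2)) isClosed_Iic)
      (by
        intro u hu
        obtain ⟨x, hx, hmax⟩ := hface u
        obtain ⟨j, hj, -⟩ := hsec u x hx x hx hmax hmax
        rw [abs_le] at hj
        rcases le_or_gt j₀ j with h | h
        · refine Or.inl ⟨(u, x), ⟨⟨⟨hu, hx⟩, hmax⟩, ?_⟩, rfl⟩
          have : (j₀ : ℝ) ≤ j := by exact_mod_cast h
          simp only [Set.mem_preimage, Set.mem_Ici]
          nlinarith
        · refine Or.inr ⟨(u, x), ⟨⟨⟨hu, hx⟩, hmax⟩, ?_⟩, rfl⟩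
          have : (j : ℝ) + 1 ≤ j₀ := by exact_mod_cast h
          simp only [Set.mem_preimage, Set.mem_Iic]
          nlinarith)
      ⟨0, ⟨le_rfl, by positivity⟩, (0, x₀), ⟨⟨⟨⟨le_rfl, by positivity⟩, hx₀⟩, hmax₀⟩, by
        simp only [Set.mem_preimage, Set.mem_Ici]
        linarith⟩, rfl⟩
      ⟨2 * Real.pi, ⟨by positivity, le_rfl⟩, (2 * Real.pi, x₀),
        ⟨⟨⟨⟨by positivity, le_rfl⟩, hx₀⟩, hmaxpi⟩, by
        simp only [Set.mem_preimage, Set.mem_Iic]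
        linarith⟩, rfl⟩
  simp only at hv
  subst hv
  obtain ⟨j, hjx, hjy⟩ := hsec v x hx.1.2 y hy.1.2 hx.2 hy.2
  simp only [Set.mem_preimage, Set.mem_Ici, Set.mem_Iic] at hx1 hy1
  rw [abs_le] at hjx hjy
  have h1 : (j₀ : ℝ) < j + 1 := by nlinarith
  have h2 : (j : ℝ) < j₀ := by nlinarith
  have h1' : j₀ < j + 1 := by exact_mod_cast h1
  have h2' : j < j₀ := by exact_mod_cast h2
  omega

/-! ### Lifts and integer translations. -/

/-- The integer vector with coordinates `k`. -/
noncomputable def intVec (k : Fin 2 → ℤ) : Plane := WithLp.toLp 2 fun i => (k i : ℝ)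

@[simp] theorem intVec_apply (k : Fin 2 → ℤ) (i : Fin 2) : intVec k i = k i := rfl

theorem continuous_proj : Continuous proj :=
  continuous_pi fun i => (AddCircle.continuous_mk' 1).comp (by fun_prop)

theorem proj_add_intVec (x : Plane) (k : Fin 2 → ℤ) : proj (x + intVec k) = proj x := by
  ext i
  simp [proj]

theorem exists_eq_add_intVec {x y : Plane} (h : proj x = proj y) :
    ∃ k, y = x + intVec k := by
  have hi : ∀ i, ∃ n : ℤ, y i - x i = n := by
    intro i
    have h1 : ((y i - x i : ℝ) : UnitAddCircle) = 0 := by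
      rw [AddCircle.coe_sub, sub_eq_zero]
      exact (congrFun h i).symm
    obtain ⟨n, hn⟩ := (AddCircle.coe_eq_zero_iff 1).1 h1
    exact ⟨n, by simpa using hn.symm⟩
  choose k hk using hi
  refine ⟨k, ?_⟩
  ext i
  simp [← hk]

theorem exists_add_intVec_mem (x : Plane) : ∃ k, ‖x + intVec k‖ ≤ 1 := by
  refine ⟨fun i => -round (x i), ?_⟩
  rw [EuclideanSpace.norm_eq]
  refine Real.sqrt_le_iff.2 ⟨by norm_num, ?_⟩
  have h1 := abs_le.1 (abs_sub_round (x 0))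
  have h2 := abs_le.1 (abs_sub_round (x 1))
  simp [Fin.sum_univ_two]
  nlinarith

/-- A lift of a homeomorphism isotopic to the identity commutes with the integer translations. -/
theorem IsLift.map_add_intVec {F : Plane → Plane} {f : Torus ≃ₜ Torus} (hF : IsLift F f)
    (hf : IsotopicToId f) (x : Plane) (k : Fin 2 → ℤ) : F (x + intVec k) = F x + intVec k := by
  obtain ⟨Φ, -⟩ := hf
  have cov := AddCircle.isCoveringMap_coe (1 : ℝ)
  ext i
  -- Lifting the displacement along the isotopy, from 0, gives a real displacement on the torus. It
  -- differs from that of `F` by a continuous integer-valued function on the plane, hence by a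
  -- constant.
  let H : C(unitInterval × Torus, UnitAddCircle) :=
    ⟨fun t => Φ t i - t.2 i, by fun_prop⟩
  have H0 : ∀ y, H (0, y) = ((0 : C(Torus, ℝ)) y : UnitAddCircle) := by
    intro y
    simp [H]
  let L := cov.liftHomotopy H 0 H0
  have hL : ∀ y, ((L (1, y) : ℝ) : UnitAddCircle) = f y i - y i := by
    intro y
    have := congrFun (cov.liftHomotopy_lifts H 0 H0) (1, y)
    refine this.trans ?_
    simp [H]
  have hLc : Continuous fun y => L (1, y) := L.continuous.comp (by fun_prop)
  have hcont : Continuous fun x : Plane => F x i - x i - L (1, proj x) :=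
    (((EuclideanSpace.proj (𝕜 := ℝ) i).continuous.comp hF.1).sub
      (EuclideanSpace.proj (𝕜 := ℝ) i).continuous).sub (hLc.comp continuous_proj)
  have hzero : ∀ x : Plane, ((F x i - x i - L (1, proj x) : ℝ) : UnitAddCircle) = 0 := by
    intro x
    rw [AddCircle.coe_sub, AddCircle.coe_sub, hL, ← hF.2]
    simp [proj]
  have := cov.const_of_comp hcont (fun a b => (hzero a).trans (hzero b).symm) (x + intVec k) x
  simp only [proj_add_intVec, PiLp.add_apply, intVec_apply] at this ⊢
  linarith

theorem IsLift.injective {F : Plane → Plane} {f : Torus ≃ₜ Torus} (hF : IsLift F f)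
    (hf : IsotopicToId f) : Function.Injective F := by
  intro x y hxy
  obtain ⟨k, rfl⟩ := exists_eq_add_intVec
    (f.injective ((hF.2 x).symm.trans ((congrArg proj hxy).trans (hF.2 y))))
  rw [hF.map_add_intVec hf, left_eq_add] at hxy
  rw [hxy, add_zero]

theorem iterate_add_intVec {F : Plane → Plane}
    (hper : ∀ x k, F (x + intVec k) = F x + intVec k) (n : ℕ) (x : Plane) (k : Fin 2 → ℤ) :
    F^[n] (x + intVec k) = F^[n] x + intVec k :=
  Function.Commute.iterate_left (g := fun x => x + intVec k) (fun x => hper x k) n x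

/-- Coarse convexity in the plane: see `exists_near_of_mem_convexHull`. -/
theorem exists_near_of_mem_convexHull_plane {G : Plane → Plane} (hG : Continuous G)
    (hinj : Function.Injective G) (hper : ∀ x k, G (x + intVec k) = G x + intVec k)
    {p : Plane} (hp : p ∈ convexHull ℝ (G '' Metric.closedBall (0 : Plane) 1)) :
    ∃ x ∈ Metric.closedBall (0 : Plane) 1, ‖G x - p‖ ≤ 5 := by
  let e : ℂ ≃ₗᵢ[ℝ] Plane := Complex.orthonormalBasisOneI.repr
  have hint : ∀ a b : ℤ, e (a + b * Complex.I) = intVec ![a, b] := by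
    intro a b
    ext i
    fin_cases i <;> simp [e, intVec]
  have hball : e '' Metric.closedBall (0 : ℂ) 1 = Metric.closedBall (0 : Plane) 1 := by
    simp
  obtain ⟨x, hx, h⟩ := exists_near_of_mem_convexHull (G := fun z => e.symm (G (e z)))
    (p := e.symm p) (e.symm.continuous.comp (hG.comp e.continuous))
    (e.symm.injective.comp (hinj.comp e.injective))
    (by
      intro x a b
      rw [map_add, hint, hper, map_add, ← hint, e.symm_apply_apply]) (by
      have h1 : (fun z => e.symm (G (e z))) '' Metric.closedBall (0 : ℂ) 1 =
          (e.symm : Plane → ℂ) '' (G '' Metric.closedBall (0 : Plane) 1) := by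
        rw [← hball, Set.image_image, Set.image_image]
      rw [h1]
      have h2 := (e.symm.toLinearEquiv.toLinearMap).image_convexHull
        (G '' Metric.closedBall (0 : Plane) 1)
      simp only [LinearEquiv.coe_coe, LinearIsometryEquiv.coe_toLinearEquiv] at h2
      rw [← h2]
      exact ⟨p, hp, rfl⟩)
  refine ⟨e x, hball ▸ ⟨x, hx, rfl⟩, ?_⟩
  simpa only [← map_sub, e.symm.norm_map] using h

/-- Every vector in the convex hull of the displacements of `G` is within a universal distance
of some displacement. -/
theorem exists_displacement_near {G : Plane → Plane} (hG : Continuous G)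
    (hinj : Function.Injective G) (hper : ∀ x k, G (x + intVec k) = G x + intVec k)
    {q : Plane} (hq : q ∈ convexHull ℝ (Set.range fun x => G x - x)) :
    ∃ x, ‖G x - x - q‖ ≤ 8 := by
  set D := Metric.closedBall (0 : Plane) 1 with hD
  have hsub : (Set.range fun x => G x - x) ⊆ Metric.thickening 2 (convexHull ℝ (G '' D)) := by
    rintro _ ⟨x, rfl⟩
    obtain ⟨k, hk⟩ := exists_add_intVec_mem x
    refine Metric.mem_thickening_iff.2
      ⟨G (x + intVec k), subset_convexHull ℝ _ ⟨_, mem_closedBall_zero_iff.2 hk, rfl⟩, ?_⟩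
    have : G x - x - G (x + intVec k) = -(x + intVec k) := by
      rw [hper]; abel
    rw [dist_eq_norm, this, norm_neg]
    linarith
  obtain ⟨p, hp, hpq⟩ := Metric.mem_thickening_iff.1
    (convexHull_min hsub ((convex_convexHull ℝ _).thickening 2) hq)
  obtain ⟨x, hx, hxp⟩ := exists_near_of_mem_convexHull_plane hG hinj hper hp
  refine ⟨x, ?_⟩
  have h1 : ‖x‖ ≤ 1 := mem_closedBall_zero_iff.1 hx
  rw [dist_eq_norm] at hpq
  have h2 : ‖G x - x - q‖ ≤ ‖G x - p‖ + ‖x‖ + ‖q - p‖ := by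
    calc ‖G x - x - q‖ = ‖(G x - p) - x - (q - p)‖ := by congr 1; abel
      _ ≤ ‖(G x - p) - x‖ + ‖q - p‖ := norm_sub_le _ _
      _ ≤ _ := by gcongr; exact norm_sub_le _ _
  -- 8 = 5 (coarse convexity) + 1 (norm of `x`) + 2 (thickening).
  linarith

/-! ### Pseudo-orbits and averaged displacements. -/

theorem exists_norm_sub_le {F : Plane → Plane} (hF : Continuous F)
    (hper : ∀ x k, F (x + intVec k) = F x + intVec k) : ∃ M, ∀ x, ‖F x - x‖ ≤ M := by
  obtain ⟨M, hM⟩ := (isCompact_closedBall (0 : Plane) 1).exists_bound_of_continuousOn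
    (f := fun x => F x - x) (hF.sub continuous_id).continuousOn
  refine ⟨M, fun x => ?_⟩
  obtain ⟨k, hk⟩ := exists_add_intVec_mem x
  have := hM _ (mem_closedBall_zero_iff.2 hk)
  rwa [hper, add_sub_add_right_eq_sub] at this

theorem exists_delta_of_periodic {F : Plane → Plane} (hF : Continuous F)
    (hper : ∀ x k, F (x + intVec k) = F x + intVec k) {η : ℝ} (hη : 0 < η) :
    ∃ δ > 0, ∀ x y, dist x y < δ → dist (F x) (F y) < η := by
  obtain ⟨δ, hδ, h⟩ := Metric.uniformContinuousOn_iff.1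
    ((isCompact_closedBall (0 : Plane) 2).uniformContinuousOn_of_continuous hF.continuousOn) η hη
  refine ⟨min δ 1, by positivity, fun x y hxy => ?_⟩
  obtain ⟨k, hk⟩ := exists_add_intVec_mem x
  have hxy' : dist (x + intVec k) (y + intVec k) < min δ 1 := by rwa [dist_add_right]
  have hy : ‖y + intVec k‖ ≤ 2 := by
    have h1 := norm_le_norm_add_norm_sub' (y + intVec k) (x + intVec k)
    rw [dist_eq_norm, norm_sub_rev] at hxy'
    linarith [hxy'.trans_le (min_le_right δ 1)]
  have := h _ (mem_closedBall_zero_iff.2 (hk.trans one_le_two)) _ (mem_closedBall_zero_iff.2 hy)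
    (hxy'.trans_le (min_le_left _ _))
  rwa [hper, hper, dist_add_right] at this

/-- Short pseudo-orbits with small jumps stay close to true orbits. -/
theorem exists_shadowing {F : Plane → Plane} (hF : Continuous F)
    (hper : ∀ x k, F (x + intVec k) = F x + intVec k) (n : ℕ) {η : ℝ} (hη : 0 < η) :
    ∃ ε > 0, ∀ x, IsPseudoOrbit F ε n x → dist (x n) (F^[n] (x 0)) < η := by
  induction n generalizing η with
  | zero => exact ⟨1, one_pos, fun x _ => by simpa using hη⟩
  | succ n ih =>
    obtain ⟨δ, hδ, hFδ⟩ := exists_delta_of_periodic hF hper (half_pos hη)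
    obtain ⟨ε, hε, h⟩ := ih hδ
    refine ⟨min ε (η / 2), by positivity, fun x hx => ?_⟩
    have h1 := hFδ _ _ (h x fun i hi => (hx i (by omega)).trans_le (min_le_left _ _))
    have h2 := (hx n (by omega)).trans_le (min_le_right _ _)
    rw [Function.iterate_succ_apply']
    rw [dist_comm] at h2
    linarith [dist_triangle (x (n + 1)) (F (x n)) (F (F^[n] (x 0)))]

theorem IsPseudoOrbit.norm_sub_le {F : Plane → Plane} {M ε : ℝ} (hM : ∀ x, ‖F x - x‖ ≤ M) {N : ℕ}
    {x : ℕ → Plane} (hx : IsPseudoOrbit F ε N x) {a b : ℕ} (hb : a + b ≤ N) :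
    ‖x (a + b) - x a‖ ≤ b * (M + ε) := by
  induction b with
  | zero => simp
  | succ b ih =>
    have h1 := ih (by omega)
    have h2 := (hx (a + b) (by omega)).le
    rw [dist_eq_norm, norm_sub_rev] at h2
    have h3 := hM (x (a + b))
    have h4 : x (a + (b + 1)) - x a = (x (a + b + 1) - F (x (a + b)))
        + (F (x (a + b)) - x (a + b)) + (x (a + b) - x a) := by
      rw [← add_assoc]; abel
    rw [h4]
    refine (norm_add₃_le).trans ?_
    push_cast
    linarith

/-- The average displacement of a pseudo-orbit over `q` blocks of length `n` is close to the
convex hull of the displacements of `F^[n]`. -/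
theorem average_mem_thickening {F : Plane → Plane} {n : ℕ} {ε : ℝ}
    (hε : ∀ x, IsPseudoOrbit F ε n x → dist (x n) (F^[n] (x 0)) < 1 / 2) {N q : ℕ} (hq : 0 < q)
    (hqN : q * n ≤ N) {x : ℕ → Plane} (hx : IsPseudoOrbit F ε N x) :
    (q : ℝ)⁻¹ • (x (q * n) - x 0) ∈
      Metric.thickening (1 / 2) (convexHull ℝ (Set.range fun y => F^[n] y - y)) := by
  have h1 : x (q * n) - x 0 = ∑ i ∈ Finset.range q, (x ((i + 1) * n) - x (i * n)) := by
    rw [Finset.sum_range_sub (fun i => x (i * n)), zero_mul]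
  rw [h1, Finset.smul_sum]
  refine ((convex_convexHull ℝ _).thickening _).sum_mem (fun _ _ => by positivity) ?_ ?_
  · simp [hq.ne']
  · intro i hi
    have hin : (i + 1) * n ≤ q * n := Nat.mul_le_mul_right n (Finset.mem_range.1 hi)
    have hin' : (i + 1) * n = i * n + n := by ring
    refine Metric.mem_thickening_iff.2 ⟨F^[n] (x (i * n)) - x (i * n),
      subset_convexHull ℝ _ ⟨_, rfl⟩, ?_⟩
    rw [dist_sub_right, hin']
    simpa using hε (fun l => x (i * n + l)) fun l hl => hx (i * n + l) (by omega)

/-- A pseudo-rotation vector `v` is, for each `n`, close to `1 / n` times the convex hull of the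
displacements of `F^[n]`. -/
theorem exists_mem_convexHull_near {F : Plane → Plane} (hF : Continuous F)
    (hper : ∀ x k, F (x + intVec k) = F x + intVec k) {v : Plane} (hv : v ∈ pseudoRotationSet F)
    {n : ℕ} (hn : 0 < n) :
    ∃ w ∈ convexHull ℝ (Set.range fun x => F^[n] x - x), ‖w - (n : ℝ) • v‖ ≤ 2 := by
  obtain ⟨M, hM⟩ := exists_norm_sub_le hF hper
  obtain ⟨ε, hε, hshadow⟩ := exists_shadowing hF hper n (η := 1 / 2) (by norm_num)
  obtain ⟨N, x, hN, hx, hlim⟩ := Set.mem_iInter₂.1 hv ε hε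
  have hMε : 0 ≤ M + ε := by linarith [(norm_nonneg _).trans (hM 0)]
  have hNr : Tendsto (fun k => (N k : ℝ)) atTop atTop := tendsto_natCast_atTop_atTop.comp hN
  have hlim' : Tendsto (fun k => (n : ℝ) • ((N k : ℝ)⁻¹ • (x k (N k) - x k 0))) atTop
      (𝓝 ((n : ℝ) • v)) := hlim.const_smul _
  -- The bound `4 * n ^ 2 * (M + ε)` makes the error from the incomplete last block at most 1/2.
  obtain ⟨k, ⟨hk1, hk2⟩, hk3⟩ := ((hN.eventually_ge_atTop n).and
    (hNr.eventually_ge_atTop (4 * (n : ℝ) ^ 2 * (M + ε)))).and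
    (Metric.tendsto_nhds.1 hlim' 1 one_pos) |>.exists
  set q := N k / n with hq
  set r := N k % n with hr
  have hqr : q * n + r = N k := Nat.div_add_mod' _ _
  have hq0 : 0 < q := Nat.div_pos hk1 hn
  have hrn : r < n := Nat.mod_lt _ hn
  obtain ⟨w, hw, hwq⟩ := Metric.mem_thickening_iff.1
    (average_mem_thickening hshadow hq0 (by omega : q * n ≤ N k) (hx k))
  refine ⟨w, hw, ?_⟩
  have hN0 : (0 : ℝ) < N k := by exact_mod_cast hn.trans_le hk1
  have hq0' : (0 : ℝ) < q := by exact_mod_cast hq0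
  have hrn' : (r : ℝ) ≤ n := by exact_mod_cast hrn.le
  have hqr' : (q : ℝ) * n + r = N k := by exact_mod_cast hqr
  have ha := (hx k).norm_sub_le hM (a := 0) (b := q * n) (by omega)
  have hb := (hx k).norm_sub_le hM (a := q * n) (b := r) (by omega)
  rw [zero_add] at ha
  rw [hqr] at hb
  push_cast at ha
  have hdiff : (q : ℝ)⁻¹ • (x k (q * n) - x k 0) -
      (n : ℝ) • ((N k : ℝ)⁻¹ • (x k (N k) - x k 0)) =
      (r / (q * N k) : ℝ) • (x k (q * n) - x k 0) -
      (n / N k : ℝ) • (x k (N k) - x k (q * n)) := by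
    have h1 : (r / (q * N k) : ℝ) = (q : ℝ)⁻¹ - n * (N k : ℝ)⁻¹ := by
      field_simp
      linarith
    rw [h1, div_eq_mul_inv]
    module
  have hsmall : ‖(q : ℝ)⁻¹ • (x k (q * n) - x k 0) -
      (n : ℝ) • ((N k : ℝ)⁻¹ • (x k (N k) - x k 0))‖ ≤ 1 / 2 := by
    rw [hdiff]
    refine (norm_sub_le _ _).trans ?_
    rw [norm_smul, norm_smul, Real.norm_of_nonneg (by positivity),
      Real.norm_of_nonneg (by positivity)]
    calc (r / (q * N k) : ℝ) * ‖x k (q * n) - x k 0‖ + (n / N k : ℝ) * ‖x k (N k) - x k (q * n)‖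
        ≤ (n / (q * N k) : ℝ) * (q * n * (M + ε)) + (n / N k : ℝ) * (n * (M + ε)) := by
          gcongr
          exact hb.trans (by gcongr)
      _ = 2 * (n : ℝ) ^ 2 * (M + ε) / N k := by field_simp; ring
      _ ≤ 1 / 2 := by
          rw [div_le_iff₀ hN0]
          linarith
  rw [dist_eq_norm] at hk3 hwq
  rw [norm_sub_rev] at hwq
  calc ‖w - (n : ℝ) • v‖ = ‖(w - (q : ℝ)⁻¹ • (x k (q * n) - x k 0)) +
        ((q : ℝ)⁻¹ • (x k (q * n) - x k 0) - (n : ℝ) • ((N k : ℝ)⁻¹ • (x k (N k) - x k 0))) +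
        ((n : ℝ) • ((N k : ℝ)⁻¹ • (x k (N k) - x k 0)) - (n : ℝ) • v)‖ := by congr 1; abel
    _ ≤ _ := norm_add₃_le
    _ ≤ 2 := by linarith

/-! ### Comparison of the rotation sets. -/

theorem pseudoRotationSet_subset_rotationSet {F : Plane → Plane} (hF : Continuous F)
    (hinj : Function.Injective F) (hper : ∀ x k, F (x + intVec k) = F x + intVec k) :
    pseudoRotationSet F ⊆ rotationSet F := by
  intro v hv
  -- 10 = 8 + 2, uniformly in `n`; the shift to `n + 1` avoids dividing by zero.
  have hstep : ∀ n : ℕ, ∃ x, ‖F^[n + 1] x - x - ((n + 1 : ℕ) : ℝ) • v‖ ≤ 10 := by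
    intro n
    obtain ⟨w, hw, hwv⟩ := exists_mem_convexHull_near hF hper hv n.succ_pos
    obtain ⟨x, hx⟩ := exists_displacement_near (hF.iterate (n + 1)) (hinj.iterate (n + 1))
      (iterate_add_intVec hper (n + 1)) hw
    refine ⟨x, (norm_sub_le_norm_sub_add_norm_sub _ w _).trans ?_⟩
    linarith
  choose z hz using hstep
  refine ⟨fun n => n + 1, z, tendsto_add_atTop_nat 1, ?_⟩
  rw [tendsto_iff_norm_sub_tendsto_zero]
  refine squeeze_zero (fun _ => norm_nonneg _) (g := fun n : ℕ => 10 / (((n + 1 : ℕ)) : ℝ)) ?_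
    ((tendsto_add_atTop_iff_nat 1).2 (tendsto_const_div_atTop_nhds_zero_nat (10 : ℝ)))
  intro n
  have hpos : (0 : ℝ) < ((n + 1 : ℕ) : ℝ) := by positivity
  have h1 : (((n + 1 : ℕ)) : ℝ)⁻¹ • (F^[n + 1] (z n) - z n) - v =
      (((n + 1 : ℕ)) : ℝ)⁻¹ • (F^[n + 1] (z n) - z n - ((n + 1 : ℕ) : ℝ) • v) := by
    rw [smul_sub _ (F^[n + 1] (z n) - z n), inv_smul_smul₀ hpos.ne']
  rw [h1, norm_smul, norm_inv, Real.norm_of_nonneg hpos.le, div_eq_inv_mul]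
  exact mul_le_mul_of_nonneg_left (hz n) (by positivity)

theorem rotationSet_subset_pseudoRotationSet (F : Plane → Plane) :
    rotationSet F ⊆ pseudoRotationSet F := by
  rintro v ⟨n, z, hn, hlim⟩
  refine Set.mem_iInter₂.2 fun ε hε => ⟨n, fun k i => F^[i] (z k), hn, fun k i _ => ?_, ?_⟩
  · simpa [Function.iterate_succ_apply'] using hε
  · simpa using hlim

end TorusRotation

theorem mainTheorem5
    (H : Set (TorusRotation.Torus ≃ₜ TorusRotation.Torus))
    (hH : H = TorusRotation.Homeo₀ ∨ H = TorusRotation.Homeo₀Area)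
    (f : TorusRotation.Torus ≃ₜ TorusRotation.Torus) (hf : f ∈ H)
    (F : TorusRotation.Plane → TorusRotation.Plane) (hF : TorusRotation.IsLift F f) :
    TorusRotation.pseudoRotationSet F = TorusRotation.rotationSet F := by
  have hiso : TorusRotation.IsotopicToId f := by
    rcases hH with rfl | rfl
    · exact hf
    · exact hf.1
  exact (TorusRotation.pseudoRotationSet_subset_rotationSet hF.1 (hF.injective hiso)
    (hF.map_add_intVec hiso)).antisymm (TorusRotation.rotationSet_subset_pseudoRotationSet F)
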